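/- Let $(\Omega,\mathcal F,\mu)$ be a finite measure space and let $E$ be a real Banach space with dual $E^*$. Let $L^1_E$ be the space of ($\mu$-a.e. classes of) Bochner $\mu$-integrable functions $f:\Omega\to E$ with the norm $\|f\|_1=\int_\Omega\|f\|\,d\mu$, and let $L^\infty_{E^*}$ be the space of (classes of) strongly measurable, essentially bounded functions from $\Omega$ to $E^*$. The topology $\sigma(L^1_E,L^\infty_{E^*})$ is the coarsest one on $L^1_E$ for which every functional $f\mapsto\int_\Omega\langle f(\omega),g(\omega)\rangle\,d\mu(\omega)$ with $g\in L^\infty_{E^*}$ is continuous. A subset of a topological space is called relatively compact if its closure is compact. For $B\in\mathcal F$ let $\mathcal F^+(B)$ be the collection of all measurable subsets of $B$ of strictly positive measure, and put $\mathcal F^+=\mathcal F^+(\Omega)$. For $f\in L^1_E$ and $A\in\mathcal F^+$ let $$m_A(f)=\frac{1}{\mu(A)}\int_A f\,d\mu,\qquad \text{Bocce-osc}\,f|_A=\frac{1}{\mu(A)}\int_A\|f-m_A(f)\|\,d\mu .$$ A set $K\subseteq L^1_E$ satisfies the Bocce criterion if for each $\varepsilon>0$ and each $B\in\mathcal F^+$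 there is a finite collection $\mathcal A\subseteq\mathcal F^+(B)$ such that for each $f\in K$ there is a set $A\in\mathcal A$ with $\text{Bocce-osc}\,f|_A<\varepsilon$. **Theorem 2.4.** A subset $K$ of $L^1_E$ is relatively norm compact if and only if 1. $K$ is relatively weakly compact (that is, relatively compact in the weak topology of the normed space $L^1_E$ given by all its continuous linear functionals), 2. $K$ satisfies the Bocce criterion, and 3. for each $B\in\mathcal F^+$ the set $\{m_B(f): f\in K\}$ is relatively norm compact in $E$. Moreover, the equivalence remains true if condition (1) is replaced with 1'. $K$ is relatively compact in the topology $\sigma(L^1_E,L^\infty_{E^*})$. -/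

import Mathlib

open MeasureTheory
open scoped ENNReal

namespace BocceL1

section

variable {Ω : Type*} {m : MeasurableSpace Ω} {E : Type*} [NormedAddCommGroup E] [NormedSpace ℝ E]

/-- The collection of all measurable subsets of `B` with strictly positive measure. -/
def posSubsets (μ : Measure Ω) (B : Set Ω) : Set (Set Ω) :=
  {A | MeasurableSet A ∧ A ⊆ B ∧ 0 < μ A}

/-- The average value `(∫_A f dμ) / μ(A)` (with `0/0 = 0`). -/
noncomputable def avg (μ : Measure Ω) (A : Set Ω) (f : Ω → E) : E :=
  ⨍ ω in A, f ω ∂μ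

/-- The Bocce oscillation `(∫_A ‖f - m_A(f)‖ dμ) / μ(A)` of `f` over `A` (with `0/0 = 0`). -/
noncomputable def bocceOsc (μ : Measure Ω) (f : Ω → E) (A : Set Ω) : ℝ :=
  ⨍ ω in A, ‖f ω - avg μ A f‖ ∂μ

theorem avg_eq (μ : Measure Ω) (A : Set Ω) (f : Ω → E) :
    avg μ A f = (μ.real A)⁻¹ • ∫ ω in A, f ω ∂μ := by
  simp [avg, setAverage_eq]

theorem bocceOsc_eq (μ : Measure Ω) (f : Ω → E) (A : Set Ω) :
    bocceOsc μ f A = (∫ ω in A, ‖f ω - avg μ A f‖ ∂μ) / μ.real A := by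
  simp [bocceOsc, setAverage_eq, div_eq_inv_mul]

/-- The Bocce criterion for a subset `K` of the Bochner space `L¹_E`. -/
def BocceCriterion {μ : Measure Ω} (K : Set (Lp E 1 μ)) : Prop :=
  ∀ ε : ℝ, 0 < ε → ∀ B ∈ posSubsets μ Set.univ,
    ∃ 𝒜 : Set (Set Ω), 𝒜.Finite ∧ 𝒜 ⊆ posSubsets μ B ∧
      ∀ f ∈ K, ∃ A ∈ 𝒜, bocceOsc μ f A < ε

/-- The pairing `⟨f, g⟩ = ∫ g(ω)(f(ω)) dμ(ω)` between `L¹_E` and the space `L^∞_{E*}` of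
strongly measurable essentially bounded functions with values in the dual of `E`;
see `pairing_apply`. -/
noncomputable def pairing (μ : Measure Ω) (E : Type*) [NormedAddCommGroup E] [NormedSpace ℝ E] :
    Lp E 1 μ →ₗ[ℝ] Lp (StrongDual ℝ E) ∞ μ →ₗ[ℝ] ℝ :=
  ContinuousLinearMap.toLinearMap₁₂
    ((ContinuousLinearMap.id ℝ (StrongDual ℝ E)).flip.lpPairing μ 1 ∞)

theorem pairing_apply (μ : Measure Ω) (f : Lp E 1 μ) (g : Lp (StrongDual ℝ E) ∞ μ) :
    pairing μ E f g = ∫ ω, g ω (f ω) ∂μ := by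
  simp [pairing, ContinuousLinearMap.lpPairing_eq_integral]

/-- `L¹_E` endowed with the topology `σ(L¹_E, L^∞_{E*})`. -/
abbrev SigmaL1 (μ : Measure Ω) (E : Type*) [NormedAddCommGroup E] [NormedSpace ℝ E] : Type _ :=
  WeakBilin (pairing μ E)

/-- The identity map from `L¹_E` (norm topology) to `L¹_E` with `σ(L¹_E, L^∞_{E*})`. -/
noncomputable def toSigmaL1 (μ : Measure Ω) (E : Type*) [NormedAddCommGroup E] [NormedSpace ℝ E] :
    Lp E 1 μ ≃ₗ[ℝ] SigmaL1 μ E :=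
  LinearEquiv.refl ℝ (Lp E 1 μ)

end

end BocceL1

open Filter Topology

namespace BocceL1

section

variable {Ω : Type*} {m : MeasurableSpace Ω} {μ : Measure Ω} {E : Type*} [NormedAddCommGroup E]

theorem integrable_coeFn (f : Lp E 1 μ) : Integrable f μ :=
  memLp_one_iff_integrable.1 (Lp.memLp f)

theorem dist_eq_integral (f g : Lp E 1 μ) : dist f g = ∫ ω, ‖f ω - g ω‖ ∂μ := by
  rw [dist_eq_norm, L1.norm_eq_integral_norm]
  refine integral_congr_ae ?_
  filter_upwards [Lp.coeFn_sub f g] with ω h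
  rw [h, Pi.sub_apply]

theorem integrableOn_norm_sub_avg [IsFiniteMeasure μ] (f : Lp E 1 μ) (A : Set Ω)
    (x : E) :
    IntegrableOn (fun ω => ‖f ω - x‖) A μ :=
  ((integrable_coeFn f).sub (integrable_const x)).norm.integrableOn

variable [NormedSpace ℝ E]

theorem continuous_pairing_weakSpace (g : Lp (StrongDual ℝ E) ∞ μ) :
    Continuous fun f : WeakSpace ℝ (Lp E 1 μ) =>
      pairing μ E ((toWeakSpace ℝ (Lp E 1 μ)).symm f) g :=
  WeakBilin.eval_continuous (topDualPairing ℝ (Lp E 1 μ)).flip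
    (((ContinuousLinearMap.id ℝ (StrongDual ℝ E)).flip.lpPairing μ 1 ∞).flip g)

theorem continuous_toSigmaL1_comp_symm :
    Continuous fun f : WeakSpace ℝ (Lp E 1 μ) =>
      toSigmaL1 μ E ((toWeakSpace ℝ (Lp E 1 μ)).symm f) :=
  WeakBilin.continuous_of_continuous_eval _ continuous_pairing_weakSpace

theorem isCompact_closure_image {X Y : Type*} [TopologicalSpace X] [TopologicalSpace Y]
    [R1Space Y] {φ : X → Y} (hφ : Continuous φ) {K : Set X} (hK : IsCompact (closure K)) :
    IsCompact (closure (φ '' K)) :=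
  (hK.image hφ).closure_of_subset (Set.image_mono subset_closure)

theorem isCompact_closure_toSigmaL1 {K : Set (Lp E 1 μ)}
    (hK : IsCompact (closure (toWeakSpace ℝ (Lp E 1 μ) '' K))) :
    IsCompact (closure (toSigmaL1 μ E '' K)) := by
  have := isCompact_closure_image continuous_toSigmaL1_comp_symm hK
  rwa [Set.image_image] at this

theorem continuous_avg (B : Set Ω) : Continuous fun f : Lp E 1 μ => avg μ B f := by
  simp only [avg_eq]
  exact (continuous_setIntegral B).const_smul _

theorem BocceCriterion.mono {K L : Set (Lp E 1 μ)} (h : K ⊆ L) (hL : BocceCriterion L) :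
    BocceCriterion K := fun ε hε B hB =>
  let ⟨𝒜, h1, h2, h3⟩ := hL ε hε B hB
  ⟨𝒜, h1, h2, fun f hf => h3 f (h hf)⟩

theorem tendsto_oscBound (g : Lp E 1 μ) (A : Set Ω) :
    Tendsto (fun f : Lp E 1 μ => bocceOsc μ g A +
      (dist f g / μ.real A + ‖avg μ A f - avg μ A g‖)) (𝓝 g) (𝓝 (bocceOsc μ g A)) := by
  have h : Continuous fun f : Lp E 1 μ => bocceOsc μ g A +
      (dist f g / μ.real A + ‖avg μ A f - avg μ A g‖) := by
    have := continuous_avg (μ := μ) (E := E) A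
    fun_prop
  simpa using h.tendsto g

variable [IsFiniteMeasure μ]

theorem bocceOsc_le_add (f g : Lp E 1 μ) {A : Set Ω} (hA : 0 < μ A) :
    bocceOsc μ f A ≤ bocceOsc μ g A + (dist f g / μ.real A + ‖avg μ A f - avg μ A g‖) := by
  have hA' : 0 < μ.real A := ENNReal.toReal_pos hA.ne' (measure_ne_top _ _)
  have hfg : IntegrableOn (fun ω => ‖f ω - g ω‖) A μ :=
    ((integrable_coeFn f).sub (integrable_coeFn g)).norm.integrableOn
  have hrest : IntegrableOn (fun ω => ‖f ω - g ω‖ + ‖avg μ A f - avg μ A g‖) A μ :=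
    hfg.add (integrable_const _)
  have key : ∫ ω in A, ‖f ω - avg μ A f‖ ∂μ ≤
      ∫ ω in A, (‖g ω - avg μ A g‖ + (‖f ω - g ω‖ + ‖avg μ A f - avg μ A g‖)) ∂μ := by
    refine integral_mono (integrableOn_norm_sub_avg f A _)
      ((integrableOn_norm_sub_avg g A _).add hrest) fun ω => ?_
    calc ‖f ω - avg μ A f‖
        = ‖(g ω - avg μ A g) + ((f ω - g ω) - (avg μ A f - avg μ A g))‖ := by congr 1; abel
      _ ≤ _ := (norm_add_le _ _).trans (by gcongr; exact norm_sub_le _ _)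
  have hle : ∫ ω in A, ‖f ω - g ω‖ ∂μ ≤ dist f g := by
    rw [dist_eq_integral]
    exact setIntegral_le_integral ((integrable_coeFn f).sub (integrable_coeFn g)).norm
      (ae_of_all _ fun _ => norm_nonneg _)
  rw [integral_add (integrableOn_norm_sub_avg g A _) hrest,
    integral_add hfg (integrable_const _), setIntegral_const, smul_eq_mul] at key
  rw [bocceOsc_eq, bocceOsc_eq, ← add_assoc, ← add_div, div_add' _ _ _ hA'.ne']
  gcongr
  linarith

theorem exists_bocceOsc_lt [CompleteSpace E] (f : Lp E 1 μ) {ε : ℝ} (hε : 0 < ε) {B : Set Ω}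
    (hB : MeasurableSet B) (hB0 : 0 < μ B) : ∃ A ∈ posSubsets μ B, bocceOsc μ f A < ε := by
  obtain ⟨c, hc, hcf⟩ := (Lp.stronglyMeasurable f).isSeparable_range
  have hcover : B ⊆ ⋃ x ∈ c, B ∩ f ⁻¹' Metric.ball x (ε / 4) := by
    intro ω hω
    obtain ⟨x, hx, hd⟩ := Metric.mem_closure_iff.1 (hcf ⟨ω, rfl⟩) (ε / 4) (by positivity)
    exact Set.mem_biUnion hx ⟨hω, hd⟩
  obtain ⟨x, -, hx⟩ : ∃ x ∈ c, 0 < μ (B ∩ f ⁻¹' Metric.ball x (ε / 4)) := by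
    by_contra! h
    exact hB0.ne' (measure_mono_null hcover
      ((measure_biUnion_null_iff hc).2 fun x hx => le_antisymm (h x hx) bot_le))
  set A := B ∩ f ⁻¹' Metric.ball x (ε / 4) with hAdef
  have hAm : MeasurableSet A := by
    refine hB.inter ?_
    have := (Lp.stronglyMeasurable f).dist (stronglyMeasurable_const (b := x))
    exact this.measurable measurableSet_Iio
  refine ⟨A, ⟨hAm, Set.inter_subset_left, hx⟩, ?_⟩
  have hA' : 0 < μ.real A := ENNReal.toReal_pos hx.ne' (measure_ne_top _ _)
  have hball : ∀ ω ∈ A, ‖f ω - x‖ ≤ ε / 4 := fun ω hω => by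
    have : dist (f ω) x < ε / 4 := hω.2
    rw [dist_eq_norm] at this
    exact this.le
  have havg : ‖avg μ A f - x‖ ≤ ε / 4 := by
    have := (convex_closedBall x (ε / 4)).set_average_mem Metric.isClosed_closedBall
      hx.ne' (measure_ne_top _ _)
      ((ae_restrict_iff' hAm).2 (ae_of_all _ fun ω hω => by
        rw [Metric.mem_closedBall, dist_eq_norm]; exact hball ω hω))
      (integrable_coeFn f).integrableOn
    rwa [Metric.mem_closedBall, dist_eq_norm] at this
  have : ∫ ω in A, ‖f ω - avg μ A f‖ ∂μ ≤ ∫ ω in A, ε / 2 ∂μ := by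
    refine setIntegral_mono_on (integrableOn_norm_sub_avg f A _)
      (integrable_const _).integrableOn hAm fun ω hω => ?_
    have := norm_sub_le (f ω - x) (avg μ A f - x)
    rw [sub_sub_sub_cancel_right] at this
    linarith [hball ω hω]
  rw [setIntegral_const, smul_eq_mul] at this
  rw [bocceOsc_eq, div_lt_iff₀ hA']
  nlinarith

theorem bocceCriterion_of_isCompact [CompleteSpace E] {K : Set (Lp E 1 μ)} (hK : IsCompact K) :
    BocceCriterion K := by
  rintro ε hε B ⟨hB, -, hB0⟩
  refine hK.induction_on (p := fun S => ∃ 𝒜 : Set (Set Ω), 𝒜.Finite ∧ 𝒜 ⊆ posSubsets μ B ∧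
      ∀ f ∈ S, ∃ A ∈ 𝒜, bocceOsc μ f A < ε) ?_ ?_ ?_ ?_
  · exact ⟨∅, Set.finite_empty, Set.empty_subset _, fun f hf => hf.elim⟩
  · rintro S T hST ⟨𝒜, h1, h2, h3⟩
    exact ⟨𝒜, h1, h2, fun f hf => h3 f (hST hf)⟩
  · rintro S T ⟨𝒜, h1, h2, h3⟩ ⟨ℬ, h4, h5, h6⟩
    refine ⟨𝒜 ∪ ℬ, h1.union h4, Set.union_subset h2 h5, ?_⟩
    rintro f (hf | hf)
    · obtain ⟨A, hA, h⟩ := h3 f hf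
      exact ⟨A, Or.inl hA, h⟩
    · obtain ⟨A, hA, h⟩ := h6 f hf
      exact ⟨A, Or.inr hA, h⟩
  · intro g _
    obtain ⟨A, hA, hosc⟩ := exists_bocceOsc_lt g hε hB hB0
    refine ⟨_, mem_nhdsWithin_of_mem_nhds ((tendsto_oscBound g A).eventually_lt_const hosc),
      {A}, Set.finite_singleton A, Set.singleton_subset_iff.2 hA, fun f hf => ⟨A, rfl, ?_⟩⟩
    exact (bocceOsc_le_add f g hA.2.2).trans_lt hf

end

section

variable {Ω : Type*} {m : MeasurableSpace Ω} {μ : Measure Ω} [IsFiniteMeasure μ]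

/-- A collection of measurable sets that meets the subsets of every set of positive measure
contains a finite disjoint subcollection that covers the whole space up to small measure. -/
theorem exists_finset_disjoint_measure_compl_lt {𝒞 : Set (Set Ω)}
    (h𝒞 : ∀ B, MeasurableSet B → 0 < μ B → ∃ A ∈ 𝒞, A ∈ posSubsets μ B)
    (hpos : ∀ A ∈ 𝒞, MeasurableSet A ∧ 0 < μ A) {δ : ℝ≥0∞} (hδ : 0 < δ) :
    ∃ s : Finset (Set Ω), (∀ A ∈ s, A ∈ 𝒞) ∧ (s : Set (Set Ω)).PairwiseDisjoint id ∧
      μ (⋃ A ∈ s, A)ᶜ < δ := by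
  obtain ⟨𝒟, h𝒟⟩ := zorn_subset {𝒟 : Set (Set Ω) | 𝒟 ⊆ 𝒞 ∧ 𝒟.PairwiseDisjoint id} <| by
    intro c hc hchain
    refine ⟨⋃₀ c, ⟨Set.sUnion_subset fun s hs => (hc hs).1, ?_⟩,
      fun s hs => Set.subset_sUnion_of_mem hs⟩
    exact (Set.pairwiseDisjoint_sUnion hchain.directedOn).2 fun s hs => (hc hs).2
  have hdisj : Pairwise (Function.onFun Disjoint fun A : 𝒟 => (A : Set Ω)) :=
    fun A B hAB => h𝒟.prop.2 A.2 B.2 fun h => hAB (Subtype.ext h)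
  have hmeas : ∀ A : 𝒟, MeasurableSet (A : Set Ω) := fun A => (hpos A (h𝒟.prop.1 A.2)).1
  have hcount : Countable 𝒟 := by
    have := Measure.countable_meas_pos_of_disjoint_iUnion (μ := μ) hmeas hdisj
    rw [Set.eq_univ_of_forall (s := {A : 𝒟 | 0 < μ (A : Set Ω)})
      fun A => (hpos A (h𝒟.prop.1 A.2)).2] at this
    exact Set.countable_univ_iff.1 this
  have hnull : μ (⋃ A : 𝒟, (A : Set Ω))ᶜ = 0 := by
    by_contra h
    obtain ⟨A, hA, hA1, hA2, hA3⟩ := h𝒞 _ (MeasurableSet.iUnion hmeas).compl (pos_iff_ne_zero.2 h)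
    have hdA : ∀ D ∈ 𝒟, Disjoint A D := fun D hD =>
      Set.disjoint_left.2 fun ω hω hωD => hA2 hω (Set.mem_iUnion.2 ⟨⟨D, hD⟩, hωD⟩)
    have hmem : A ∈ 𝒟 := by
      refine h𝒟.le_of_ge (y := insert A 𝒟) ⟨Set.insert_subset hA h𝒟.prop.1, ?_⟩
        (Set.subset_insert A 𝒟) (Set.mem_insert A 𝒟)
      exact h𝒟.prop.2.insert fun D hD _ => hdA D hD
    rw [disjoint_self.1 (hdA A hmem)] at hA3
    simp at hA3
  have hsum : ∑' A : 𝒟, μ (A : Set Ω) ≠ ∞ := by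
    rw [← measure_iUnion hdisj hmeas]
    exact measure_ne_top _ _
  obtain ⟨s, hs⟩ := ((ENNReal.tendsto_tsum_compl_atTop_zero hsum).eventually_lt_const hδ).exists
  refine ⟨s.map (Function.Embedding.subtype _), ?_, ?_, ?_⟩
  · simp only [Finset.mem_map, Function.Embedding.subtype_apply]
    rintro A ⟨D, -, rfl⟩
    exact h𝒟.prop.1 D.2
  · refine h𝒟.prop.2.subset ?_
    simp only [Finset.coe_map, Function.Embedding.subtype_apply]
    rintro A ⟨D, -, rfl⟩
    exact D.2
  · calc μ (⋃ A ∈ s.map (Function.Embedding.subtype _), A)ᶜ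
        ≤ μ ((⋃ A : {A : 𝒟 // A ∉ s}, (A.1 : Set Ω)) ∪ (⋃ A : 𝒟, (A : Set Ω))ᶜ) := by
          refine measure_mono fun ω hω => ?_
          by_cases h : ω ∈ ⋃ A : 𝒟, (A : Set Ω)
          · obtain ⟨A, hA⟩ := Set.mem_iUnion.1 h
            refine Or.inl (Set.mem_iUnion.2 ⟨⟨A, fun hAs => hω ?_⟩, hA⟩)
            exact Set.mem_biUnion (Finset.mem_map.2 ⟨A, hAs, rfl⟩) hA
          · exact Or.inr h
      _ ≤ μ (⋃ A : {A : 𝒟 // A ∉ s}, (A.1 : Set Ω)) + 0 := by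
          rw [← hnull]; exact measure_union_le _ _
      _ ≤ ∑' A : {A : 𝒟 // A ∉ s}, μ (A.1 : Set Ω) := by
          rw [add_zero]; exact measure_iUnion_le _
      _ < δ := hs

variable {E : Type*} [NormedAddCommGroup E] [NormedSpace ℝ E]

theorem setIntegral_norm_sub_le (f g : Lp E 1 μ) (A : Set Ω) :
    ∫ ω in A, ‖f ω - g ω‖ ∂μ ≤
      (bocceOsc μ f A + bocceOsc μ g A + ‖avg μ A f - avg μ A g‖) * μ.real A := by
  have hosc : ∀ h : Lp E 1 μ, bocceOsc μ h A * μ.real A = ∫ ω in A, ‖h ω - avg μ A h‖ ∂μ := by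
    intro h
    rcases eq_or_ne (μ.real A) 0 with h0 | h0
    · rw [h0, mul_zero, Measure.restrict_eq_zero.2 ((measureReal_eq_zero_iff).1 h0),
        integral_zero_measure]
    · rw [bocceOsc_eq, div_mul_cancel₀ _ h0]
  have hfg : IntegrableOn (fun ω => ‖f ω - g ω‖) A μ :=
    ((integrable_coeFn f).sub (integrable_coeFn g)).norm.integrableOn
  have hi : IntegrableOn (fun ω => ‖f ω - avg μ A f‖ + ‖g ω - avg μ A g‖) A μ :=
    (integrableOn_norm_sub_avg f A (avg μ A f)).add
    (integrableOn_norm_sub_avg g A (avg μ A g))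
  rw [add_mul, add_mul, hosc, hosc, ← integral_add (integrableOn_norm_sub_avg f A _)
    (integrableOn_norm_sub_avg g A _), mul_comm _ (μ.real A), ← smul_eq_mul, ← setIntegral_const,
    ← integral_add hi (integrable_const _)]
  refine integral_mono hfg (hi.add (integrable_const _)) fun ω => ?_
  calc ‖f ω - g ω‖
      = ‖((f ω - avg μ A f) - (g ω - avg μ A g)) + (avg μ A f - avg μ A g)‖ := by congr 1; abel
    _ ≤ _ := (norm_add_le _ _).trans (by gcongr; exact norm_sub_le _ _)

/-- Equi-integrability of a set of functions on a finite measure space. -/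
def EquiIntegrable (K : Set (Lp E 1 μ)) : Prop :=
  ∀ η : ℝ, 0 < η → ∃ δ : ℝ≥0∞, 0 < δ ∧ ∀ f ∈ K, ∀ A, MeasurableSet A → μ A < δ →
    ∫ ω in A, ‖f ω‖ ∂μ < η

theorem totallyBounded_of_equiIntegrable {K : Set (Lp E 1 μ)}
    (hK : EquiIntegrable K) (hosc : BocceCriterion K)
    (havg : ∀ B ∈ posSubsets μ Set.univ, IsCompact (closure {x : E | ∃ f ∈ K, x = avg μ B f})) :
    TotallyBounded K := by
  refine totallyBounded_iff_ultrafilter.2 fun 𝒰 h𝒰 => ?_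
  have hKU : ∀ᶠ f : Lp E 1 μ in (𝒰 : Filter (Lp E 1 μ)), f ∈ K := le_principal_iff.1 h𝒰
  refine Metric.cauchy_iff.2 ⟨𝒰.neBot, fun ε hε => ?_⟩
  obtain ⟨η, hη, hηε⟩ : ∃ η : ℝ, 0 < η ∧ 4 * η * μ.real Set.univ + 2 * η < ε := by
    refine ⟨ε / (2 * (4 * μ.real Set.univ + 2)), by positivity, ?_⟩
    have h : (0 : ℝ) < 4 * μ.real Set.univ + 2 := by positivity
    have : 4 * (ε / (2 * (4 * μ.real Set.univ + 2))) * μ.real Set.univ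
        + 2 * (ε / (2 * (4 * μ.real Set.univ + 2))) = ε / 2 := by
      field_simp
    linarith
  obtain ⟨δ, hδ, hequi⟩ := hK η hη
  obtain ⟨s, hs𝒞, hsd, hsδ⟩ := exists_finset_disjoint_measure_compl_lt (μ := μ)
    (𝒞 := {A | A ∈ posSubsets μ Set.univ ∧
      ∀ᶠ f : Lp E 1 μ in (𝒰 : Filter (Lp E 1 μ)), bocceOsc μ f A < η})
    (fun B hB hB0 => by
      obtain ⟨𝒜, h𝒜, h𝒜B, hf⟩ := hosc η hη B ⟨hB, Set.subset_univ B, hB0⟩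
      have : ∀ᶠ f : Lp E 1 μ in (𝒰 : Filter (Lp E 1 μ)), ∃ A ∈ 𝒜, bocceOsc μ f A < η := hKU.mono hf
      obtain ⟨A, hA, hAf⟩ := (Ultrafilter.eventually_exists_mem_iff h𝒜).1 this
      exact ⟨A, ⟨⟨(h𝒜B hA).1, Set.subset_univ A, (h𝒜B hA).2.2⟩, hAf⟩, h𝒜B hA⟩)
    (fun A hA => ⟨hA.1.1, hA.1.2.2⟩) hδ
  have hx : ∀ A ∈ s, ∃ x, ∀ᶠ f : Lp E 1 μ in (𝒰 : Filter (Lp E 1 μ)), ‖avg μ A f - x‖ < η := by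
    intro A hA
    obtain ⟨x, -, hx⟩ := (havg A (hs𝒞 A hA).1).ultrafilter_le_nhds
      (𝒰.map fun f : Lp E 1 μ => avg μ A f) (le_principal_iff.2 (by
        rw [Ultrafilter.coe_map]
        exact mem_map.2 (hKU.mono fun f hf => subset_closure ⟨f, hf, rfl⟩)))
    refine ⟨x, ?_⟩
    rw [Ultrafilter.coe_map] at hx
    simpa only [dist_eq_norm] using
      (show Tendsto _ _ _ from hx).eventually (Metric.ball_mem_nhds x hη)
  choose! x hx using hx
  have hev : ∀ᶠ f : Lp E 1 μ in (𝒰 : Filter (Lp E 1 μ)), f ∈ K ∧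
      ∀ A ∈ s, bocceOsc μ f A < η ∧ ‖avg μ A f - x A‖ < η :=
    hKU.and ((eventually_all_finset s).2 fun A hA => (hs𝒞 A hA).2.and (hx A hA))
  refine ⟨_, hev, ?_⟩
  rintro f ⟨hf, hfs⟩ g ⟨hg, hgs⟩
  have hms : ∀ A ∈ s, MeasurableSet A := fun A hA => (hs𝒞 A hA).1.1
  have hmU : MeasurableSet (⋃ A ∈ s, A) := Finset.measurableSet_biUnion s hms
  have hint : Integrable (fun ω => ‖f ω - g ω‖) μ :=
    ((integrable_coeFn f).sub (integrable_coeFn g)).norm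
  rw [dist_eq_integral, ← integral_add_compl hmU hint,
    integral_biUnion_finset s hms hsd fun A _ => hint.integrableOn]
  have h1 : ∑ A ∈ s, ∫ ω in A, ‖f ω - g ω‖ ∂μ ≤ 4 * η * μ.real Set.univ := by
    calc ∑ A ∈ s, ∫ ω in A, ‖f ω - g ω‖ ∂μ ≤ ∑ A ∈ s, 4 * η * μ.real A := by
          refine Finset.sum_le_sum fun A hA => (setIntegral_norm_sub_le f g A).trans ?_
          gcongr
          have := norm_sub_le (avg μ A f - x A) (avg μ A g - x A)
          rw [sub_sub_sub_cancel_right] at this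
          linarith [(hfs A hA).1, (hfs A hA).2, (hgs A hA).1, (hgs A hA).2]
      _ = 4 * η * μ.real (⋃ A ∈ s, A) := by
          rw [← Finset.mul_sum]
          exact congrArg _ (measureReal_biUnion_finset hsd hms).symm
      _ ≤ _ := by
          gcongr
          exacts [measure_ne_top _ _, Set.subset_univ _]
  have h2 : ∫ ω in (⋃ A ∈ s, A)ᶜ, ‖f ω - g ω‖ ∂μ ≤ 2 * η := by
    calc ∫ ω in (⋃ A ∈ s, A)ᶜ, ‖f ω - g ω‖ ∂μ
        ≤ ∫ ω in (⋃ A ∈ s, A)ᶜ, (‖f ω‖ + ‖g ω‖) ∂μ :=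
          integral_mono hint.integrableOn ((integrable_coeFn f).norm.integrableOn.add
            (integrable_coeFn g).norm.integrableOn) fun ω => norm_sub_le _ _
      _ = _ := integral_add (integrable_coeFn f).norm.integrableOn
            (integrable_coeFn g).norm.integrableOn
      _ ≤ 2 * η := by
          linarith [hequi f hf _ hmU.compl hsδ, hequi g hg _ hmU.compl hsδ]
  linarith

end

section

variable {Ω : Type*} {m : MeasurableSpace Ω} {μ : Measure Ω}
  {E : Type*} [NormedAddCommGroup E] [NormedSpace ℝ E]

/-- The strongly measurable functions with values a.e. in the unit ball of the dual. -/
def dualBall (μ : Measure Ω) (E : Type*) [NormedAddCommGroup E] [NormedSpace ℝ E] :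
    Set (Ω → StrongDual ℝ E) :=
  {G | StronglyMeasurable G ∧ ∀ᵐ ω ∂μ, ‖G ω‖ ≤ 1}

/-- The pairing `∫ G(ω)(f(ω)) dμ(ω)` for functions `G` that are not classes. -/
noncomputable def dualPair (f : Lp E 1 μ) (G : Ω → StrongDual ℝ E) : ℝ :=
  ∫ ω, G ω (f ω) ∂μ

theorem integrable_dual_apply {F : Ω → E} (hF : Integrable F μ) {G : Ω → StrongDual ℝ E}
    (hG : G ∈ dualBall μ E) : Integrable (fun ω => G ω (F ω)) μ := by
  refine hF.norm.mono' (isBoundedBilinearMap_apply.continuous.comp_aestronglyMeasurable₂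
    hG.1.aestronglyMeasurable hF.aestronglyMeasurable) ?_
  filter_upwards [hG.2] with ω hω
  exact (G ω).le_of_opNorm_le_of_le hω le_rfl |>.trans (by rw [one_mul])

theorem dualPair_sub_left (f g : Lp E 1 μ) {G : Ω → StrongDual ℝ E} (hG : G ∈ dualBall μ E) :
    dualPair (f - g) G = dualPair f G - dualPair g G := by
  rw [dualPair, dualPair, dualPair, ← integral_sub (integrable_dual_apply (integrable_coeFn f) hG)
    (integrable_dual_apply (integrable_coeFn g) hG)]
  refine integral_congr_ae ?_
  filter_upwards [Lp.coeFn_sub f g] with ω h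
  rw [h, Pi.sub_apply, map_sub]

theorem continuous_dualPair {G : Ω → StrongDual ℝ E} (hG : G ∈ dualBall μ E) :
    Continuous fun x : SigmaL1 μ E => dualPair ((toSigmaL1 μ E).symm x) G := by
  have hL : MemLp G ∞ μ := memLp_top_of_bound hG.1.aestronglyMeasurable 1 hG.2
  have h : (fun x : SigmaL1 μ E => dualPair ((toSigmaL1 μ E).symm x) G) =
      fun x => pairing μ E ((toSigmaL1 μ E).symm x) hL.toLp := by
    funext x
    rw [pairing_apply]
    refine integral_congr_ae ?_
    filter_upwards [hL.coeFn_toLp] with ω h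
    rw [h]
  rw [h]
  exact WeakBilin.eval_continuous (pairing μ E) hL.toLp

theorem abs_dualPair_sub_le (f : Lp E 1 μ) {G G' : Ω → StrongDual ℝ E} (hG : G ∈ dualBall μ E)
    (hG' : G' ∈ dualBall μ E) {A : Set Ω} (hA : MeasurableSet A) (h : ∀ ω ∉ A, G' ω = G ω) :
    |dualPair f G' - dualPair f G| ≤ 2 * ∫ ω in A, ‖f ω‖ ∂μ := by
  rw [dualPair, dualPair, ← integral_sub (integrable_dual_apply (integrable_coeFn f) hG')
    (integrable_dual_apply (integrable_coeFn f) hG),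
    ← integral_const_mul, ← integral_indicator hA]
  rw [← Real.norm_eq_abs]
  refine norm_integral_le_of_norm_le
    (((integrable_coeFn f).norm.const_mul 2).indicator hA) ?_
  filter_upwards [hG.2, hG'.2] with ω h1 h2
  by_cases hω : ω ∈ A
  · rw [Set.indicator_of_mem hω, ← sub_apply]
    exact (G' ω - G ω).le_of_opNorm_le_of_le ((norm_sub_le _ _).trans (by linarith)) le_rfl
  · rw [Set.indicator_of_notMem hω, h ω hω, sub_self, norm_zero]

theorem tendsto_dualPair (f : Lp E 1 μ) {G : ℕ → Ω → StrongDual ℝ E} {L : Ω → StrongDual ℝ E}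
    (hG : ∀ n, G n ∈ dualBall μ E)
    (hlim : ∀ᵐ ω ∂μ, Tendsto (fun n => G n ω) atTop (𝓝 (L ω))) :
    Tendsto (fun n => dualPair f (G n)) atTop (𝓝 (dualPair f L)) := by
  refine tendsto_integral_of_dominated_convergence (fun ω => ‖f ω‖)
    (fun n => (integrable_dual_apply (integrable_coeFn f) (hG n)).aestronglyMeasurable)
    (integrable_coeFn f).norm (fun n => ?_) ?_
  · filter_upwards [(hG n).2] with ω hω
    exact (G n ω).le_of_opNorm_le_of_le hω le_rfl |>.trans (by rw [one_mul])
  · filter_upwards [hlim] with ω hω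
    exact ((ContinuousLinearMap.apply ℝ ℝ (f ω)).continuous.tendsto _).comp hω

theorem exists_dualBall_norming (f : Lp E 1 μ) {A : Set Ω} {r : ℝ}
    (hr : r < ∫ ω in A, ‖f ω‖ ∂μ) :
    ∃ g ∈ dualBall μ E, r < ∫ ω in A, g ω (f ω) ∂μ := by
  set η : ℝ := (∫ ω in A, ‖f ω‖ ∂μ) - r with hη
  have hη0 : 0 < η := by linarith
  obtain ⟨s, hs, hsL⟩ := (Lp.memLp f).exists_simpleFunc_eLpNorm_sub_lt ENNReal.one_ne_top
    (ε := ENNReal.ofReal (η / 2)) (by simpa using hη0)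
  rw [memLp_one_iff_integrable] at hsL
  have hfs : ∫ ω, ‖f ω - s ω‖ ∂μ < η / 2 := by
    have hi := ((integrable_coeFn f).sub hsL)
    rw [eLpNorm_one_eq_lintegral_enorm, ← ofReal_integral_norm_eq_lintegral_enorm hi] at hs
    exact (ENNReal.ofReal_lt_ofReal_iff (by positivity)).1 hs
  choose φ hφ1 hφ using fun x : E => exists_dual_vector'' ℝ x
  have hg : (⇑(s.map φ) : Ω → StrongDual ℝ E) ∈ dualBall μ E :=
    ⟨(s.map φ).stronglyMeasurable, ae_of_all _ fun ω => hφ1 _⟩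
  refine ⟨s.map φ, hg, ?_⟩
  have hd : Integrable (fun ω => f ω - s ω) μ := (integrable_coeFn f).sub hsL
  have hle : ∫ ω in A, ‖f ω - s ω‖ ∂μ ≤ ∫ ω, ‖f ω - s ω‖ ∂μ :=
    setIntegral_le_integral hd.norm (ae_of_all _ fun _ => norm_nonneg _)
  have key : (∫ ω in A, ‖f ω‖ ∂μ) - ∫ ω in A, 2 * ‖f ω - s ω‖ ∂μ ≤
      ∫ ω in A, s.map φ ω (f ω) ∂μ := by
    rw [← integral_sub (integrable_coeFn f).norm.integrableOn (hd.norm.const_mul 2).integrableOn]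
    refine integral_mono ((integrable_coeFn f).norm.sub (hd.norm.const_mul 2)).integrableOn
      (integrable_dual_apply (integrable_coeFn f) hg).integrableOn fun ω => ?_
    have h1 : |φ (s ω) (f ω - s ω)| ≤ 1 * ‖f ω - s ω‖ :=
      (φ (s ω)).le_of_opNorm_le_of_le (hφ1 _) le_rfl
    have h2 : φ (s ω) (s ω) = ‖s ω‖ := hφ _
    have h3 := norm_sub_norm_le (f ω) (s ω)
    have h4 := neg_le_of_abs_le h1
    rw [map_sub] at h4
    simp only [SimpleFunc.map_apply]
    linarith
  rw [integral_const_mul] at key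
  linarith

theorem exists_dualBall_modification (f : Lp E 1 μ) {A : Set Ω} (hA : MeasurableSet A) {r : ℝ}
    (hr : r < ∫ ω in A, ‖f ω‖ ∂μ) {G : Ω → StrongDual ℝ E} (hG : G ∈ dualBall μ E) :
    ∃ G' ∈ dualBall μ E, (∀ ω ∉ A, G' ω = G ω) ∧ r < |dualPair f G'| := by
  classical
  obtain ⟨g, hg, hgr⟩ := exists_dualBall_norming f hr
  have hpw : ∀ g' ∈ dualBall μ E, A.piecewise g' G ∈ dualBall μ E ∧
      dualPair f (A.piecewise g' G) =
        (∫ ω in A, g' ω (f ω) ∂μ) + ∫ ω in Aᶜ, G ω (f ω) ∂μ := by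
    intro g' hg'
    have hmem : A.piecewise g' G ∈ dualBall μ E := by
      refine ⟨hg'.1.piecewise hA hG.1, ?_⟩
      filter_upwards [hg'.2, hG.2] with ω h1 h2
      by_cases hω : ω ∈ A <;> simp [hω, h1, h2]
    refine ⟨hmem, ?_⟩
    rw [dualPair, ← integral_add_compl hA (integrable_dual_apply (integrable_coeFn f) hmem)]
    congr 1
    · exact setIntegral_congr_fun hA fun ω hω => by simp [hω]
    · exact setIntegral_congr_fun hA.compl fun ω hω => by
        simp [Set.piecewise_eq_of_notMem _ _ _ hω]
  have hng : -g ∈ dualBall μ E := ⟨hg.1.neg, by simpa using hg.2⟩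
  obtain ⟨h1, h2⟩ := hpw g hg
  obtain ⟨h3, h4⟩ := hpw (-g) hng
  have h5 : ∫ ω in A, (-g) ω (f ω) ∂μ = -∫ ω in A, g ω (f ω) ∂μ := by
    rw [← integral_neg]; rfl
  rcases le_total 0 (∫ ω in Aᶜ, G ω (f ω) ∂μ) with h | h
  · exact ⟨_, h1, fun ω hω => Set.piecewise_eq_of_notMem _ _ _ hω,
      lt_of_lt_of_le (by rw [h2]; linarith) (le_abs_self _)⟩
  · exact ⟨_, h3, fun ω hω => Set.piecewise_eq_of_notMem _ _ _ hω,
      lt_of_lt_of_le (by rw [h4, h5]; linarith) (neg_le_abs _)⟩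

end

section

variable {Ω : Type*} {m : MeasurableSpace Ω} {μ : Measure Ω}
  {E : Type*} [NormedAddCommGroup E] [NormedSpace ℝ E]

/-- One step of the gliding hump: if functions `h n` have mass on sets `A n` of vanishing measure
and cluster at `0`, then `G` can be modified on some `A n` so as to pair with `h n`, while its
pairings with finitely many given functions stay large. -/
theorem exists_hump {h : ℕ → Lp E 1 μ} {A : ℕ → Set Ω} {c : ℝ}
    (hA : ∀ n, MeasurableSet (A n)) (hA0 : Tendsto (fun n => μ (A n)) atTop (𝓝 0))
    (hmass : ∀ᶠ n in atTop, c < ∫ ω in A n, ‖h n ω‖ ∂μ)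
    (hclus : ∀ 𝒢 : Finset (Ω → StrongDual ℝ E), (∀ g ∈ 𝒢, g ∈ dualBall μ E) → ∀ r : ℝ, 0 < r →
      ∃ᶠ n in atTop, ∀ g ∈ 𝒢, |dualPair (h n) g| < r)
    (F : Finset (Lp E 1 μ)) (𝒢 : Finset (Ω → StrongDual ℝ E)) (h𝒢 : ∀ g ∈ 𝒢, g ∈ dualBall μ E)
    {G : Ω → StrongDual ℝ E} (hG : G ∈ dualBall μ E) (hF : ∀ f ∈ F, c < |dualPair f G|)
    (k : ℕ) {r : ℝ} (hr : 0 < r) :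
    ∃ n ≥ k, ∃ G' ∈ dualBall μ E, (∀ ω ∉ A n, G' ω = G ω) ∧ c < |dualPair (h n) G'| ∧
      (∀ f ∈ F, c < |dualPair f G'|) ∧ ∀ g ∈ 𝒢, |dualPair (h n) g| < r := by
  have hstab : ∀ᶠ n in atTop, ∀ f ∈ F, c < |dualPair f G| - 2 * ∫ ω in A n, ‖f ω‖ ∂μ := by
    refine (eventually_all_finset F).2 fun f hf => ?_
    have h1 := (integrable_coeFn f).norm.tendsto_setIntegral_nhds_zero hA0
    have h2 := (h1.const_mul 2).const_sub |dualPair f G|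
    rw [mul_zero, sub_zero] at h2
    exact h2.eventually_const_lt (hF f hf)
  obtain ⟨n, hn, ⟨hnm, hns⟩, hnk⟩ := ((hclus 𝒢 h𝒢 r hr).and_eventually
    ((hmass.and hstab).and (eventually_ge_atTop k))).exists
  obtain ⟨G', hG', hGG', hc⟩ := exists_dualBall_modification (h n) (hA n) hnm hG
  refine ⟨n, hnk, G', hG', hGG', hc, fun f hf => ?_, hn⟩
  have h1 := abs_dualPair_sub_le f hG hG' (hA n) hGG'
  have h2 := abs_sub_abs_le_abs_sub (dualPair f G) (dualPair f G')
  rw [abs_sub_comm] at h2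
  linarith [hns f hf]

/-- The gliding hump: along a subsequence all the functions pair with a single element of the
dual ball, which is the limit of elements with which they asymptotically do not pair. -/
theorem exists_gliding_hump {h : ℕ → Lp E 1 μ} {A : ℕ → Set Ω} {c : ℝ}
    (hA : ∀ n, MeasurableSet (A n)) (hA2 : ∀ n, μ (A n) ≤ 2⁻¹ ^ n)
    (hmass : ∀ᶠ n in atTop, c < ∫ ω in A n, ‖h n ω‖ ∂μ)
    (hclus : ∀ 𝒢 : Finset (Ω → StrongDual ℝ E), (∀ g ∈ 𝒢, g ∈ dualBall μ E) → ∀ r : ℝ, 0 < r →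
      ∃ᶠ n in atTop, ∀ g ∈ 𝒢, |dualPair (h n) g| < r) :
    ∃ (n : ℕ → ℕ) (G : ℕ → Ω → StrongDual ℝ E) (L : Ω → StrongDual ℝ E),
      (∀ j, G j ∈ dualBall μ E) ∧ L ∈ dualBall μ E ∧
      (∀ f : Lp E 1 μ, Tendsto (fun j => dualPair f (G j)) atTop (𝓝 (dualPair f L))) ∧
      (∀ j, Tendsto (fun k => dualPair (h (n k)) (G j)) atTop (𝓝 0)) ∧
      ∀ k, c ≤ |dualPair (h (n k)) L| := by
  classical
  have hgeom : ∑' n : ℕ, (2⁻¹ : ℝ≥0∞) ^ n ≠ ∞ := by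
    rw [ENNReal.tsum_geometric, ENNReal.one_sub_inv_two, inv_inv]
    exact ENNReal.ofNat_ne_top
  have hA0 : Tendsto (fun n => μ (A n)) atTop (𝓝 0) :=
    tendsto_of_tendsto_of_tendsto_of_le_of_le tendsto_const_nhds
      (ENNReal.tendsto_pow_atTop_nhds_zero_of_lt_one ENNReal.one_half_lt_one)
      (fun _ => bot_le) hA2
  let State := {p : Finset (Lp E 1 μ) × Finset (Ω → StrongDual ℝ E) × (Ω → StrongDual ℝ E) //
    (∀ g ∈ p.2.1, g ∈ dualBall μ E) ∧ p.2.2 ∈ dualBall μ E ∧ ∀ f ∈ p.1, c < |dualPair f p.2.2|}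
  have hstep : ∀ (k : ℕ) (p : State), ∃ (q : State) (n : ℕ), k ≤ n ∧
      q.1.1 = insert (h n) p.1.1 ∧ q.1.2.1 = insert q.1.2.2 p.1.2.1 ∧
      (∀ ω ∉ A n, q.1.2.2 ω = p.1.2.2 ω) ∧
      ∀ g ∈ p.1.2.1, |dualPair (h n) g| < 1 / ((k : ℝ) + 1) := by
    rintro k ⟨⟨F, 𝒢, G⟩, h𝒢, hG, hF⟩
    obtain ⟨n, hn, G', hG', h1, h2, h3, h4⟩ :=
      exists_hump hA hA0 hmass hclus F 𝒢 h𝒢 hG hF k (Nat.one_div_pos_of_nat (α := ℝ) (n := k))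
    exact ⟨⟨⟨insert (h n) F, insert G' 𝒢, G'⟩,
      (Finset.forall_mem_insert _ _ _).2 ⟨hG', h𝒢⟩, hG',
      (Finset.forall_mem_insert _ _ _).2 ⟨h2, h3⟩⟩, n, hn, rfl, rfl, h1, h4⟩
  choose next N hN hF h𝒢 hGA hsmall using hstep
  have h0 : (0 : Ω → StrongDual ℝ E) ∈ dualBall μ E :=
    ⟨stronglyMeasurable_zero, ae_of_all _ fun _ => by simp⟩
  let S : ℕ → State := fun k => Nat.rec ⟨⟨∅, ∅, 0⟩, by simp, h0, by simp⟩ next k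
  have hS : ∀ k, S (k + 1) = next k (S k) := fun k => rfl
  set n : ℕ → ℕ := fun k => N k (S k) with hn
  set G : ℕ → Ω → StrongDual ℝ E := fun k => (S (k + 1)).1.2.2 with hGdef
  have hG : ∀ j, G j ∈ dualBall μ E := fun j => (S (j + 1)).2.2.1
  have hFmono : Monotone fun k => (S k).1.1 := monotone_nat_of_le_succ fun k => by
    rw [hS, hF]; exact Finset.subset_insert _ _
  have h𝒢mono : Monotone fun k => (S k).1.2.1 := monotone_nat_of_le_succ fun k => by
    rw [hS, h𝒢]; exact Finset.subset_insert _ _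
  have hmemF : ∀ k, h (n k) ∈ (S (k + 1)).1.1 := fun k => by
    rw [hS, hF]; exact Finset.mem_insert_self _ _
  have hmem𝒢 : ∀ k, G k ∈ (S (k + 1)).1.2.1 := fun k => by
    rw [hGdef]
    simp only [hS]
    rw [h𝒢]; exact Finset.mem_insert_self _ _
  have hconv : ∀ᵐ ω ∂μ, ∃ l, Tendsto (fun j => G j ω) atTop (𝓝 l) := by
    have hs : ∑' k, μ (A (n (k + 1))) ≠ ∞ := by
      refine ne_top_of_le_ne_top hgeom (ENNReal.tsum_le_tsum fun k => (hA2 _).trans ?_)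
      exact pow_le_pow_of_le_one bot_le (by simp) ((Nat.le_succ k).trans (hN _ _))
    filter_upwards [ae_eventually_notMem hs] with ω hω
    obtain ⟨j, hj⟩ := eventually_atTop.1 hω
    refine ⟨G j ω, tendsto_const_nhds.congr' (eventually_atTop.2 ⟨j, fun i hi => ?_⟩)⟩
    induction i, hi using Nat.le_induction with
    | base => rfl
    | succ i hi ih => rw [ih]; exact (hGA (i + 1) (S (i + 1)) ω (hj i hi)).symm
  obtain ⟨L, hL, hlim⟩ := exists_stronglyMeasurable_limit_of_tendsto_ae
    (fun j => (hG j).1.aestronglyMeasurable) hconv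
  have hLmem : L ∈ dualBall μ E := by
    refine ⟨hL, ?_⟩
    filter_upwards [hlim, ae_all_iff.2 fun j => (hG j).2] with ω h1 h2
    exact le_of_tendsto h1.norm (Eventually.of_forall h2)
  have hpair := fun f : Lp E 1 μ => tendsto_dualPair f hG hlim
  refine ⟨n, G, L, hG, hLmem, hpair, fun j => ?_, fun k => ?_⟩
  · refine squeeze_zero_norm' (a := fun k : ℕ => 1 / ((k : ℝ) + 1)) ?_
      tendsto_one_div_add_atTop_nhds_zero_nat
    filter_upwards [eventually_ge_atTop (j + 1)] with k hk
    exact (hsmall k (S k) _ (h𝒢mono hk (hmem𝒢 j))).le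
  · refine ge_of_tendsto (hpair _).abs ?_
    filter_upwards [eventually_ge_atTop k] with j hj
    exact ((S (j + 1)).2.2.2 _ (hFmono (Nat.succ_le_succ hj) (hmemF k))).le

/-- Relative compactness for `σ(L¹_E, L^∞_{E*})` implies equi-integrability. -/
theorem equiIntegrable_of_isCompact {K : Set (Lp E 1 μ)}
    (hK : IsCompact (closure (toSigmaL1 μ E '' K))) : EquiIntegrable K := by
  by_contra hcon
  simp only [EquiIntegrable, not_forall, not_exists, not_and, not_lt] at hcon
  obtain ⟨η, hη, hcon⟩ := hcon
  have hex : ∀ n : ℕ, ∃ f ∈ K, ∃ A, MeasurableSet A ∧ μ A ≤ 2⁻¹ ^ n ∧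
      η ≤ ∫ ω in A, ‖f ω‖ ∂μ := by
    intro n
    obtain ⟨f, hf, A, hA, hA2, h⟩ := hcon (2⁻¹ ^ n) (ENNReal.pow_pos (by simp) n)
    exact ⟨f, hf, A, hA, hA2.le, h⟩
  choose f hf A hA hA2 hfA using hex
  have hcluster : ∀ n : ℕ → ℕ, ∃ x, MapClusterPt x atTop fun k => toSigmaL1 μ E (f (n k)) := by
    intro n
    obtain ⟨x, -, hx⟩ := hK.exists_mapClusterPt (f := atTop)
      (u := fun k => toSigmaL1 μ E (f (n k)))
      (le_principal_iff.2 (mem_map.2 (Eventually.of_forall fun k =>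
        subset_closure ⟨_, hf (n k), rfl⟩)))
    exact ⟨x, hx⟩
  obtain ⟨x, hx⟩ := hcluster id
  set f₀ : Lp E 1 μ := (toSigmaL1 μ E).symm x with hf₀
  have hcont : ∀ {g : Ω → StrongDual ℝ E}, g ∈ dualBall μ E →
      Continuous fun y : SigmaL1 μ E => |dualPair ((toSigmaL1 μ E).symm y) g - dualPair f₀ g| :=
    fun hg => ((continuous_dualPair hg).sub continuous_const).abs
  have hA0 : Tendsto (fun n => μ (A n)) atTop (𝓝 0) :=
    tendsto_of_tendsto_of_tendsto_of_le_of_le tendsto_const_nhds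
      (ENNReal.tendsto_pow_atTop_nhds_zero_of_lt_one ENNReal.one_half_lt_one)
      (fun _ => bot_le) hA2
  have hmass : ∀ᶠ n in atTop, η / 2 < ∫ ω in A n, ‖(f n - f₀ : Lp E 1 μ) ω‖ ∂μ := by
    have h1 := (integrable_coeFn f₀).norm.tendsto_setIntegral_nhds_zero hA0
    filter_upwards [h1.eventually_lt_const (half_pos hη)] with n hn
    have h2 : ∫ ω in A n, ‖f n ω‖ ∂μ ≤
        ∫ ω in A n, (‖(f n - f₀ : Lp E 1 μ) ω‖ + ‖f₀ ω‖) ∂μ := by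
      refine setIntegral_mono_ae (integrable_coeFn _).norm.integrableOn
        ((integrable_coeFn _).norm.add (integrable_coeFn _).norm).integrableOn ?_
      filter_upwards [Lp.coeFn_sub (f n) f₀] with ω hω
      rw [hω, Pi.sub_apply]
      simpa using norm_add_le (f n ω - f₀ ω) (f₀ ω)
    rw [integral_add (integrable_coeFn _).norm.integrableOn
      (integrable_coeFn _).norm.integrableOn] at h2
    linarith [hfA n]
  obtain ⟨n, G, L, hG, hL, hGL, hsmall, hlarge⟩ := exists_gliding_hump hA hA2 hmass <| by
    intro 𝒢 h𝒢 r hr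
    refine (hx.frequently (p := fun y => ∀ g ∈ 𝒢,
      |dualPair ((toSigmaL1 μ E).symm y) g - dualPair f₀ g| < r) ?_).mono fun k hk g hg => ?_
    · refine (eventually_all_finset 𝒢).2 fun g hg => ?_
      refine (hcont (h𝒢 g hg)).tendsto x |>.eventually_lt_const ?_
      simpa [hf₀] using hr
    · rw [dualPair_sub_left _ _ (h𝒢 g hg)]
      simpa using hk g hg
  obtain ⟨y, hy⟩ := hcluster n
  set f₁ : Lp E 1 μ := (toSigmaL1 μ E).symm y with hf₁
  have hzero : ∀ j, dualPair (f₁ - f₀) (G j) = 0 := by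
    intro j
    by_contra h
    rw [dualPair_sub_left _ _ (hG j)] at h
    have h1 := hy.frequently (((hcont (hG j)).tendsto y).eventually_const_lt
      (half_lt_self (abs_pos.2 h)))
    have h2 := (hsmall j).abs.eventually_lt_const (u := |dualPair f₁ (G j) - dualPair f₀ (G j)| / 2)
      (by simpa using abs_pos.2 h)
    obtain ⟨k, hk1, hk2⟩ := (h1.and_eventually h2).exists
    rw [dualPair_sub_left _ _ (hG j)] at hk2
    rw [LinearEquiv.symm_apply_apply] at hk1
    exact hk1.not_gt hk2
  have hL0 : dualPair (f₁ - f₀) L = 0 :=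
    tendsto_nhds_unique (hGL _) (by simp only [hzero]; exact tendsto_const_nhds)
  have h1 := hy.frequently (((hcont hL).tendsto y).eventually_lt_const (u := η / 2) (by
    rw [← hf₁, ← dualPair_sub_left _ _ hL, hL0, abs_zero]; exact half_pos hη))
  obtain ⟨k, hk⟩ := h1.exists
  have h2 := hlarge k
  rw [dualPair_sub_left _ _ hL] at h2
  rw [LinearEquiv.symm_apply_apply] at hk
  exact hk.not_ge h2

theorem isCompact_closure_of_sigma [IsFiniteMeasure μ] [CompleteSpace E] {K : Set (Lp E 1 μ)}
    (hK : IsCompact (closure (toSigmaL1 μ E '' K))) (hosc : BocceCriterion K)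
    (havg : ∀ B ∈ posSubsets μ Set.univ, IsCompact (closure {x : E | ∃ f ∈ K, x = avg μ B f})) :
    IsCompact (closure K) :=
  (totallyBounded_of_equiIntegrable
    (equiIntegrable_of_isCompact hK) hosc havg).closure.isCompact_of_isClosed isClosed_closure

theorem isCompact_closure_avg {K : Set (Lp E 1 μ)} (hK : IsCompact (closure K)) (B : Set Ω) :
    IsCompact (closure {x : E | ∃ f ∈ K, x = avg μ B f}) := by
  have h : {x : E | ∃ f ∈ K, x = avg μ B f} = (fun f : Lp E 1 μ => avg μ B f) '' K :=
    Set.ext fun x => exists_congr fun f => and_congr_right fun _ => eq_comm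
  rw [h]
  exact isCompact_closure_image (continuous_avg B) hK

end

end BocceL1

theorem theorem2p4 {Ω : Type*} [MeasurableSpace Ω] (μ : Measure Ω) [IsFiniteMeasure μ]
    {E : Type*} [NormedAddCommGroup E] [NormedSpace ℝ E] [CompleteSpace E]
    (K : Set (Lp E 1 μ)) :
    (IsCompact (closure K) ↔
      IsCompact (closure (toWeakSpace ℝ (Lp E 1 μ) '' K)) ∧
      BocceL1.BocceCriterion K ∧
      ∀ B ∈ BocceL1.posSubsets μ Set.univ,
        IsCompact (closure {x : E | ∃ f ∈ K, x = BocceL1.avg μ B f})) ∧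
    (IsCompact (closure K) ↔
      IsCompact (closure (BocceL1.toSigmaL1 μ E '' K)) ∧
      BocceL1.BocceCriterion K ∧
      ∀ B ∈ BocceL1.posSubsets μ Set.univ,
        IsCompact (closure {x : E | ∃ f ∈ K, x = BocceL1.avg μ B f})) := by
  have hweak (hK : IsCompact (closure K)) :
      IsCompact (closure (toWeakSpace ℝ (Lp E 1 μ) '' K)) :=
    BocceL1.isCompact_closure_image (toWeakSpaceCLM ℝ (Lp E 1 μ)).continuous hK
  have hrest (hK : IsCompact (closure K)) := And.intro
    ((BocceL1.bocceCriterion_of_isCompact hK).mono subset_closure)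
    fun B (_ : B ∈ BocceL1.posSubsets μ Set.univ) => BocceL1.isCompact_closure_avg hK B
  exact ⟨⟨fun hK => ⟨hweak hK, hrest hK⟩, fun ⟨h1, h2, h3⟩ =>
      BocceL1.isCompact_closure_of_sigma (BocceL1.isCompact_closure_toSigmaL1 h1) h2 h3⟩,
    ⟨fun hK => ⟨BocceL1.isCompact_closure_toSigmaL1 (hweak hK), hrest hK⟩, fun ⟨h1, h2, h3⟩ =>
      BocceL1.isCompact_closure_of_sigma h1 h2 h3⟩⟩
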